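/- Let $G$ be a group. A subgroup $H$ of $G$ is \emph{pronormal} in $G$ if for every $g\in G$ the subgroups $H$ and $H^g$ are conjugate in $\langle H,H^g\rangle$. Say that $G$ satisfies $\mathrm{ac}_{pr}$ if there is no infinite antichain $(H_\lambda)_{\lambda\in\Lambda}$ of subgroups of $G$ with $H_\lambda H_\mu=H_\mu H_\lambda$ for all $\lambda,\mu\in\Lambda$ such that (1) $H_\lambda\not\le\bigvee_{\gamma\in\Lambda\setminus\{\lambda\}}H_\gamma$ for every $\lambda\in\Lambda$, and (2) for every infinite $\Lambda_0\subseteq\Lambda$ the join $\bigvee_{\lambda\in\Lambda_0}H_\lambda$ is not pronormal in $G$. The \emph{total rank} of an abelian group $A$ is $r_0(A)+\sum_p r_p(A)$, where $r_0$ is the torsion-free rank and $r_p$ is the $p$-rank, $p$ ranging over all primes; a group is said to have \emph{infinite total rank} if it has an abelian subgroup of infinite total rank. The \emph{Hirsch--Plotkin radical} of $G$ is the subgroup generated by all normal locally nilpotent subgroups of $G$. \textbf{Theorem.} Let $G$ be a group satisfying $\mathrm{ac}_{pr}$. If the Hirsch--Plotkin radical of $G$ has infinite total rank, then $G$ is a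 $\overline{T}$-group; that is, for every subgroup $K$ of $G$, every subnormal subgroup of $K$ is normal in $K$. -/

import Mathlib

open scoped Pointwise

universe u

namespace GroupAntichain

section Subgroups

variable {G : Type u} [Group G]

/-- `H` is pronormal in `G`: for every `g`, the subgroups `H` and its conjugate by `g` are
conjugate by an element of their join. -/
def IsPronormal (H : Subgroup G) : Prop :=
  ∀ g : G, ∃ x ∈ H ⊔ MulAut.conj g • H, MulAut.conj x • H = MulAut.conj g • H

/-- `H` and `K` permute: `HK = KH` as subsets of `G`. -/
def Permute (H K : Subgroup G) : Prop :=
  (H : Set G) * (K : Set G) = (K : Set G) * (H : Set G)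

/-- The families that the antichain condition forbids: infinite antichains of pairwise permuting
subgroups, none of which lies in the join of the others, and such that the join of every infinite
subfamily fails to have the property `χ`. -/
structure IsBadFamily (χ : Subgroup G → Prop) {Λ : Type u} (H : Λ → Subgroup G) : Prop where
  infinite : Infinite Λ
  antichain : ∀ i j : Λ, i ≠ j → ¬ H i ≤ H j
  permute : ∀ i j : Λ, Permute (H i) (H j)
  not_le_join : ∀ i : Λ, ¬ H i ≤ ⨆ j ∈ {j : Λ | j ≠ i}, H j
  join_not : ∀ Λ₀ : Set Λ, Λ₀.Infinite → ¬ χ (⨆ j ∈ Λ₀, H j)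

/-- The antichain condition on non-`χ` subgroups of `G`. Index types in the universe of `G`
suffice, because a forbidden family is injective and may be restricted to a countable one. -/
def AntichainCondition (χ : Subgroup G → Prop) : Prop :=
  ∀ (Λ : Type u) (H : Λ → Subgroup G), ¬ IsBadFamily χ H

end Subgroups

section Classes

variable (G : Type u) [Group G]

/-- Every finitely generated subgroup is nilpotent. -/
def IsLocallyNilpotent : Prop :=
  ∀ H : Subgroup G, H.FG → Group.IsNilpotent H

/-- The Hirsch–Plotkin radical: the subgroup generated by all the normal locally nilpotent
subgroups. -/
def hirschPlotkinRadical : Subgroup G :=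
  sSup {N : Subgroup G | N.Normal ∧ IsLocallyNilpotent N}

/-- Every subnormal subgroup is normal. -/
def IsTGroup : Prop :=
  ∀ H : Subgroup G, H.IsSubnormal → H.Normal

/-- Every subgroup is a `T`-group. -/
def IsTBarGroup : Prop :=
  ∀ K : Subgroup G, IsTGroup K

end Classes

section Rank

open Cardinal

/-- The torsion-free rank `r₀` of an abelian group: the largest size of a subset that is linearly
independent over `ℤ`. -/
noncomputable def torsionFreeRank (A : Type u) [CommGroup A] : Cardinal.{u} :=
  Module.rank ℤ (Additive A)

/-- The `p`-rank of an abelian group: the dimension over `ℤ/p` of the subgroup of all the elements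
whose order divides `p`. -/
noncomputable def pRank (p : ℕ) (A : Type u) [CommGroup A] : Cardinal.{u} :=
  letI : Module (ZMod p) (AddSubgroup.torsionBy (Additive A) (p : ℤ)) :=
    AddSubgroup.torsionBy.zmodModule
  Module.rank (ZMod p) (AddSubgroup.torsionBy (Additive A) (p : ℤ))

/-- The total rank `r₀ + ∑ₚ rₚ` of an abelian group. -/
noncomputable def totalRank (A : Type u) [CommGroup A] : Cardinal.{u} :=
  torsionFreeRank A + Cardinal.sum fun p : Nat.Primes => pRank p A

open scoped IsMulCommutative in
/-- A group has infinite total rank if one of its abelian subgroups has infinite total rank, in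
other words, if it does not have finite abelian total rank. -/
def HasInfiniteTotalRank (G : Type u) [Group G] : Prop :=
  ∃ (A : Subgroup G) (_ : IsMulCommutative A), ℵ₀ ≤ totalRank A

end Rank

end GroupAntichain

/-! Let `R` be the Hirsch–Plotkin radical. It is locally nilpotent, so pronormal subgroups of `G`
inside `R` are normal (`IsPronormal.normal_of_le`). Infinite total rank gives an infinite
independent sequence `a` in `R`, and the antichain condition is used only through
`IsIndependentSeq.exists_sup_of_antichainCondition`: if `X` normalizes every `⟨a n⟩` and meets `⟨a n
: n ∈ S⟩` trivially, with `S` infinite, then `X⟨a n : n ∈ I⟩` is pronormal for some infinite `I ⊆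
S`. Doing this for two disjoint index sets and intersecting recovers `X`.

With `X = ⟨b⟩`, this makes every cyclic subgroup of `⟨a n : n ∈ ℕ⟩` normal in `G`. Now let `X` be
normal in `Y`, let `k` normalize `Y`, and let `x ∈ X`. Pronormality of `⟨x⟩B`, for suitable normal
`B` generated by terms of an independent sequence, puts the conjugate of `x` by `k` in `XB`. If `X`
avoids a tail of `a`, two choices of `B` intersect to give `X`; otherwise `B` can be chosen inside
`X`. So normality is transitive in every subgroup. -/

namespace GroupAntichain

/-! ### Fitting's theorem and finitely generated conjugate closures. -/

section LocallyNilpotent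

variable {G : Type u} [Group G]

open scoped commutatorElement

/-- Bounding `P` by a subgroup independent of `P` makes commutator bounds pass to joins. -/
theorem commutator_le_iff_le_comap_centralizer {P Q R : Subgroup G} [R.Normal] :
    ⁅P, Q⁆ ≤ R ↔ P ≤ (Subgroup.centralizer
      (Q.map (QuotientGroup.mk' R) : Set (G ⧸ R))).comap (QuotientGroup.mk' R) := by
  rw [← Subgroup.map_le_iff_le_comap, ← Subgroup.commutator_eq_bot_iff_le_centralizer,
    ← Subgroup.map_commutator, Subgroup.map_eq_bot_iff, QuotientGroup.ker_mk']

theorem iSup_commutator_le {ι : Sort*} {P : ι → Subgroup G} {Q R : Subgroup G} [R.Normal]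
    (h : ∀ i, ⁅P i, Q⁆ ≤ R) : ⁅⨆ i, P i, Q⁆ ≤ R :=
  commutator_le_iff_le_comap_centralizer.2 <|
    iSup_le fun i => commutator_le_iff_le_comap_centralizer.1 (h i)

theorem commutator_sup_le {P Q₁ Q₂ R : Subgroup G} [R.Normal]
    (h₁ : ⁅P, Q₁⁆ ≤ R) (h₂ : ⁅P, Q₂⁆ ≤ R) : ⁅P, Q₁ ⊔ Q₂⁆ ≤ R := by
  rw [Subgroup.commutator_comm] at h₁ h₂ ⊢
  exact commutator_le_iff_le_comap_centralizer.2 <|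
    sup_le (commutator_le_iff_le_comap_centralizer.1 h₁)
      (commutator_le_iff_le_comap_centralizer.1 h₂)

/-- The lower central series of `N`, preceded by the whole group. -/
def extendedLowerCentralSeries (N : Subgroup G) : ℕ → Subgroup G
  | 0 => ⊤
  | i + 1 => N.lowerCentralSeries i

instance (N : Subgroup G) [N.Normal] (i : ℕ) : (extendedLowerCentralSeries N i).Normal := by
  cases i <;> unfold extendedLowerCentralSeries <;> infer_instance

theorem commutator_extendedLowerCentralSeries_le (N : Subgroup G) [N.Normal] (i : ℕ) :
    ⁅extendedLowerCentralSeries N i, N⁆ ≤ extendedLowerCentralSeries N (i + 1) := by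
  cases i with
  | zero => exact Subgroup.commutator_le_right _ _
  | succ i => exact le_rfl

theorem extendedLowerCentralSeries_antitone (N : Subgroup G) :
    Antitone (extendedLowerCentralSeries N) := by
  refine antitone_nat_of_succ_le fun n => ?_
  cases n with
  | zero => exact le_top
  | succ n => exact N.lowerCentralSeries_antitone n.le_succ

/-- Weight count: a commutator with `i` entries from `N` and `j` from `M` lies in the `i`-th term
for `N` and the `j`-th for `M`. The shifted indexing makes zero entries impose no constraint. -/
theorem lowerCentralSeries_sup_le (N M : Subgroup G) [N.Normal] [M.Normal] (n : ℕ) :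
    (N ⊔ M).lowerCentralSeries n ≤ ⨆ p : {p : ℕ × ℕ // p.1 + p.2 = n + 1},
      extendedLowerCentralSeries N p.1.1 ⊓ extendedLowerCentralSeries M p.1.2 := by
  induction n with
  | zero =>
    refine sup_le ?_ ?_
    · exact le_iSup_of_le ⟨(1, 0), rfl⟩ (le_inf le_rfl le_top)
    · exact le_iSup_of_le ⟨(0, 1), rfl⟩ (le_inf le_top le_rfl)
  | succ n ih =>
    have : (⨆ p : {p : ℕ × ℕ // p.1 + p.2 = n + 1 + 1},
      extendedLowerCentralSeries N p.1.1 ⊓ extendedLowerCentralSeries M p.1.2).Normal :=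
      Subgroup.iSup_normal _
    refine (Subgroup.commutator_mono ih le_rfl).trans (iSup_commutator_le ?_)
    rintro ⟨⟨i, j⟩, hij : i + j = n + 1⟩
    refine commutator_sup_le ?_ ?_
    · refine le_iSup_of_le ⟨(i + 1, j), by simp only; omega⟩ (le_inf ?_ ?_)
      · exact (Subgroup.commutator_mono inf_le_left le_rfl).trans
          (commutator_extendedLowerCentralSeries_le N i)
      · exact (Subgroup.commutator_mono inf_le_right le_rfl).trans (Subgroup.commutator_le_left _ _)
    · refine le_iSup_of_le ⟨(i, j + 1), by simp only; omega⟩ (le_inf ?_ ?_)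
      · exact (Subgroup.commutator_mono inf_le_left le_rfl).trans (Subgroup.commutator_le_left _ _)
      · exact (Subgroup.commutator_mono inf_le_right le_rfl).trans
          (commutator_extendedLowerCentralSeries_le M j)

/-- Fitting's theorem. -/
theorem isNilpotent_sup_of_normal {N M : Subgroup G} [N.Normal] [M.Normal]
    (hN : Group.IsNilpotent N) (hM : Group.IsNilpotent M) :
    Group.IsNilpotent (N ⊔ M : Subgroup G) := by
  rw [Subgroup.isNilpotent_iff_lowerCentralSeries] at *
  obtain ⟨c, hc⟩ := hN
  obtain ⟨d, hd⟩ := hM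
  -- The weights then add up to `c + d + 2`, forcing `i ≥ c + 1` or `j ≥ d + 1`, where the shifted
  -- series vanish.
  refine ⟨c + d + 1, le_bot_iff.1 ((lowerCentralSeries_sup_le N M _).trans (iSup_le ?_))⟩
  rintro ⟨⟨i, j⟩, hij : i + j = c + d + 1 + 1⟩
  rcases Nat.lt_or_ge c i with h | h
  · exact inf_le_left.trans ((extendedLowerCentralSeries_antitone N h).trans hc.le)
  · exact inf_le_right.trans
      ((extendedLowerCentralSeries_antitone M (show d + 1 ≤ j by omega)).trans hd.le)

theorem isNilpotent_of_le {H K : Subgroup G} (h : H ≤ K) (hK : Group.IsNilpotent K) :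
    Group.IsNilpotent H :=
  Group.nilpotent_of_mulEquiv (Subgroup.subgroupOfEquivOfLe h)

theorem isNilpotent_sup_of_le_normalizer {U V : Subgroup G}
    (hUV : U ≤ Subgroup.normalizer (V : Set G)) (hVU : V ≤ Subgroup.normalizer (U : Set G))
    (hU : Group.IsNilpotent U) (hV : Group.IsNilpotent V) :
    Group.IsNilpotent (U ⊔ V : Subgroup G) := by
  have nU : (U.subgroupOf (U ⊔ V)).Normal :=
    (Subgroup.normal_subgroupOf_iff_le_normalizer le_sup_left).2
      (sup_le Subgroup.le_normalizer hVU)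
  have nV : (V.subgroupOf (U ⊔ V)).Normal :=
    (Subgroup.normal_subgroupOf_iff_le_normalizer le_sup_right).2
      (sup_le hUV Subgroup.le_normalizer)
  have h := isNilpotent_sup_of_normal (N := U.subgroupOf (U ⊔ V)) (M := V.subgroupOf (U ⊔ V))
    (Group.nilpotent_of_mulEquiv (Subgroup.subgroupOfEquivOfLe le_sup_left).symm)
    (Group.nilpotent_of_mulEquiv (Subgroup.subgroupOfEquivOfLe le_sup_right).symm)
  rw [← Subgroup.subgroupOf_sup le_sup_left le_sup_right, Subgroup.subgroupOf_self] at h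
  exact Group.isNilpotent_top.1 h

theorem isLocallyNilpotent_iff {N : Subgroup G} :
    IsLocallyNilpotent N ↔ ∀ H ≤ N, H.FG → Group.IsNilpotent H := by
  constructor
  · intro h H hH hfg
    have : (H.subgroupOf N).FG := by
      rw [← Group.fg_iff_subgroup_fg] at hfg ⊢
      exact Group.fg_of_surjective (f := (Subgroup.subgroupOfEquivOfLe hH).symm.toMonoidHom)
        (Subgroup.subgroupOfEquivOfLe hH).symm.surjective
    have := h _ this
    exact Group.nilpotent_of_mulEquiv (Subgroup.subgroupOfEquivOfLe hH)
  · intro h H hH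
    have hfg : (H.map N.subtype).FG := by
      rw [← Group.fg_iff_subgroup_fg] at hH ⊢
      exact Group.fg_of_surjective
        (f := (H.equivMapOfInjective N.subtype N.subtype_injective).toMonoidHom)
        (H.equivMapOfInjective N.subtype N.subtype_injective).surjective
    have := h (H.map N.subtype) (Subgroup.map_subtype_le H) hfg
    exact Group.nilpotent_of_mulEquiv
      (H.equivMapOfInjective N.subtype N.subtype_injective).symm

/-- Closure under inverses matters: conjugation by `s` alone might map the subgroup properly into
itself. -/
theorem closure_le_normalizer_closure {S T : Set G} (hS : ∀ s ∈ S, s⁻¹ ∈ S)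
    (h : ∀ s ∈ S, ∀ t ∈ T, s * t * s⁻¹ ∈ Subgroup.closure T) :
    Subgroup.closure S ≤ Subgroup.normalizer (Subgroup.closure T : Set G) := by
  have key : ∀ s ∈ S, ∀ t ∈ Subgroup.closure T, s * t * s⁻¹ ∈ Subgroup.closure T := by
    intro s hs t ht
    have : Subgroup.closure T ≤ (Subgroup.closure T).comap (MulAut.conj s).toMonoidHom :=
      (Subgroup.closure_le _).2 fun t ht => h s hs t ht
    exact this ht
  refine (Subgroup.closure_le _).2 fun s hs => Subgroup.mem_normalizer_iff.2 fun t =>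
    ⟨key s hs t, fun ht => ?_⟩
  have := key _ (hS s hs) _ ht
  group at this
  simpa using this

/-- The subgroup generated by the conjugates of the elements of `C` by the elements of `X`. -/
def conjClosure (X : Subgroup G) (C : Set G) : Subgroup G :=
  Subgroup.closure {g | ∃ x ∈ X, ∃ c ∈ C, g = x * c * x⁻¹}

theorem subset_conjClosure (X : Subgroup G) (C : Set G) : C ⊆ conjClosure X C :=
  fun c hc => Subgroup.subset_closure ⟨1, X.one_mem, c, hc, by simp⟩

theorem le_normalizer_conjClosure (X : Subgroup G) (C : Set G) :
    X ≤ Subgroup.normalizer (conjClosure X C : Set G) := by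
  conv_lhs => rw [← X.closure_eq]
  refine closure_le_normalizer_closure (fun s hs => X.inv_mem hs) ?_
  rintro s hs _ ⟨x, hx, c, hc, rfl⟩
  exact Subgroup.subset_closure ⟨s * x, X.mul_mem hs hx, c, hc, by group⟩

theorem conjClosure_le {X : Subgroup G} {C : Set G} {W : Subgroup G} (hC : C ⊆ W)
    (hX : X ≤ Subgroup.normalizer (W : Set G)) : conjClosure X C ≤ W := by
  refine (Subgroup.closure_le _).2 ?_
  rintro _ ⟨x, hx, c, hc, rfl⟩
  exact (Subgroup.mem_normalizer_iff.1 (hX hx) c).1 (hC hc)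

/-- Iterated commutators `[c, s₁, …, s_k]` suffice as generators, since `s d s⁻¹ = [d, s]⁻¹ d`.
Nilpotency leaves only finitely many nontrivial ones. -/
theorem conjClosure_fg {S C : Set G} (hS : S.Finite) (hSi : ∀ s ∈ S, s⁻¹ ∈ S) (hC : C.Finite)
    (hnil : Group.IsNilpotent (Subgroup.closure (C ∪ S))) :
    (conjClosure (Subgroup.closure S) C).FG := by
  obtain ⟨n, hn⟩ := (Subgroup.isNilpotent_iff_lowerCentralSeries _).1 hnil
  let D : ℕ → Set G := fun k => Nat.rec C (fun _ E => Set.image2 (fun d s => ⁅d, s⁆) E S) k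
  have hDsucc : ∀ k, D (k + 1) = Set.image2 (fun d s => ⁅d, s⁆) (D k) S := fun _ => rfl
  have hDfin : ∀ k, (D k).Finite := by
    intro k
    induction k with
    | zero => exact hC
    | succ k ih => exact ih.image2 _ hS
  have hDl : ∀ k, D k ⊆ (Subgroup.closure (C ∪ S)).lowerCentralSeries k := by
    intro k
    induction k with
    | zero => exact fun c hc => Subgroup.subset_closure (Or.inl hc)
    | succ k ih =>
      rintro _ ⟨d, hd, s, hs, rfl⟩
      exact Subgroup.commutator_mem_commutator (ih hd) (Subgroup.subset_closure (Or.inr hs))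
  have hDW : ∀ k, D k ⊆ conjClosure (Subgroup.closure S) C := by
    intro k
    induction k with
    | zero => exact subset_conjClosure _ _
    | succ k ih =>
      rintro _ ⟨d, hd, s, hs, rfl⟩
      have h := (Subgroup.mem_normalizer_iff.1 (le_normalizer_conjClosure _ C
        (Subgroup.subset_closure hs)) _).1 (Subgroup.inv_mem _ (ih hd))
      have := Subgroup.mul_mem _ (ih hd) h
      rw [← mul_assoc, ← mul_assoc] at this
      exact this
  let E : Set G := ⋃ k ∈ Set.Iio (n + 1), D k
  have hE : E.Finite := (Set.finite_Iio _).biUnion fun k _ => hDfin k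
  have hDE : ∀ k, D k ⊆ Subgroup.closure E := by
    intro k
    rcases Nat.lt_or_ge k (n + 1) with h | h
    · exact fun d hd => Subgroup.subset_closure (Set.mem_biUnion h hd)
    · intro d hd
      have := (Subgroup.lowerCentralSeries_antitone _ (by omega : n ≤ k)) (hDl k hd)
      rw [hn, Subgroup.mem_bot] at this
      exact this ▸ Subgroup.one_mem _
  have : conjClosure (Subgroup.closure S) C = Subgroup.closure E := by
    refine le_antisymm (conjClosure_le (hDE 0) (closure_le_normalizer_closure hSi ?_))
      ((Subgroup.closure_le _).2 (Set.iUnion₂_subset fun k _ => hDW k))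
    intro s hs d hd
    obtain ⟨k, -, hk⟩ := Set.mem_iUnion₂.1 hd
    have h1 : ⁅d, s⁆ ∈ Subgroup.closure E := hDE (k + 1) ⟨d, hk, s, hs, rfl⟩
    have := Subgroup.mul_mem _ (Subgroup.inv_mem _ h1) (hDE k hk)
    rw [commutatorElement_def] at this
    group at this ⊢
    exact this
  rw [this]
  exact ⟨hE.toFinset, by simp⟩

end LocallyNilpotent

/-! ### The Hirsch–Plotkin theorem, and pronormality in locally nilpotent groups. -/

section HirschPlotkin

variable {G : Type u} [Group G]

open scoped commutatorElement

theorem exists_finite_of_mem_closure {A : Set G} {x : G} (hx : x ∈ Subgroup.closure A) :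
    ∃ T ⊆ A, T.Finite ∧ x ∈ Subgroup.closure T := by
  induction hx using Subgroup.closure_induction with
  | mem x hx =>
    exact ⟨{x}, by simpa using hx, Set.finite_singleton x, Subgroup.subset_closure rfl⟩
  | one => exact ⟨∅, by simp, Set.finite_empty, Subgroup.one_mem _⟩
  | mul x y _ _ hx hy =>
    obtain ⟨S, hSA, hS, hxS⟩ := hx
    obtain ⟨T, hTA, hT, hyT⟩ := hy
    exact ⟨S ∪ T, Set.union_subset hSA hTA, hS.union hT, Subgroup.mul_mem _
      (Subgroup.closure_mono Set.subset_union_left hxS)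
      (Subgroup.closure_mono Set.subset_union_right hyT)⟩
  | inv x _ hx =>
    obtain ⟨S, hSA, hS, hxS⟩ := hx
    exact ⟨S, hSA, hS, Subgroup.inv_mem _ hxS⟩

theorem closure_fg_of_finite {S : Set G} (hS : S.Finite) : (Subgroup.closure S).FG :=
  (Subgroup.fg_iff _).2 ⟨S, rfl, hS⟩

theorem IsLocallyNilpotent.isNilpotent_of_fg {N H : Subgroup G} (hN : IsLocallyNilpotent N)
    (hH : H ≤ N) (hfg : H.FG) : Group.IsNilpotent H :=
  isLocallyNilpotent_iff.1 hN H hH hfg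

/-- The commutators `[s, t]` lie in `N ⊓ M`. Closing them under `⟨S⟩` (inside `N`) and then under
`⟨T⟩` (inside `M`) gives a finitely generated `W` normalized by both. The nilpotent groups `⟨S⟩W`
and `⟨T⟩W` normalize each other, so Fitting's theorem applies. -/
theorem isNilpotent_closure_union {N M : Subgroup G} [N.Normal] [M.Normal]
    (hN : IsLocallyNilpotent N) (hM : IsLocallyNilpotent M) {S T : Set G}
    (hS : S.Finite) (hT : T.Finite) (hSi : ∀ s ∈ S, s⁻¹ ∈ S) (hTi : ∀ t ∈ T, t⁻¹ ∈ T)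
    (hSN : S ⊆ N) (hTM : T ⊆ M) : Group.IsNilpotent (Subgroup.closure (S ∪ T)) := by
  have hNM (X : Subgroup G) : X ≤ Subgroup.normalizer (N ⊓ M : Subgroup G) :=
    Subgroup.le_normalizer_of_normal
  have hSN' : Subgroup.closure S ≤ N := (Subgroup.closure_le _).2 hSN
  have hTM' : Subgroup.closure T ≤ M := (Subgroup.closure_le _).2 hTM
  let C : Set G := Set.image2 (fun s t => ⁅s, t⁆) S T
  have hC : C.Finite := hS.image2 _ hT
  have hCNM : C ⊆ (N ⊓ M : Subgroup G) := by
    rintro _ ⟨s, hs, t, ht, rfl⟩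
    exact Subgroup.commutator_le_inf _ _ (Subgroup.commutator_mem_commutator (hSN hs) (hTM ht))
  set W₁ := conjClosure (Subgroup.closure S) C with hW₁
  have hW₁NM : W₁ ≤ N ⊓ M := conjClosure_le hCNM (hNM _)
  have hW₁fg : W₁.FG := conjClosure_fg hS hSi hC <| hN.isNilpotent_of_fg
    ((Subgroup.closure_le _).2 (Set.union_subset (fun c hc => (hCNM hc).1) hSN))
    (closure_fg_of_finite (hC.union hS))
  obtain ⟨D, hD, hDfin⟩ := (Subgroup.fg_iff _).1 hW₁fg
  have hDW : D ⊆ W₁ := hD ▸ Subgroup.subset_closure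
  set W := conjClosure (Subgroup.closure T) D with hW
  have hWNM : W ≤ N ⊓ M := conjClosure_le (hDW.trans hW₁NM) (hNM _)
  have hWfg : W.FG := conjClosure_fg hT hTi hDfin <| hM.isNilpotent_of_fg
    ((Subgroup.closure_le _).2 (Set.union_subset (fun d hd => (hW₁NM (hDW hd)).2) hTM))
    (closure_fg_of_finite (hDfin.union hT))
  have hW₁W : W₁ ≤ W := hD ▸ (Subgroup.closure_le _).2 (subset_conjClosure _ D)
  have hTW : Subgroup.closure T ≤ Subgroup.normalizer (W : Set G) := le_normalizer_conjClosure _ D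
  have hCW : ∀ s ∈ S, ∀ t ∈ T, ⁅s, t⁆ ∈ W := fun s hs t ht =>
    hW₁W (subset_conjClosure _ C ⟨s, hs, t, ht, rfl⟩)
  have hST : ∀ s ∈ S, ∀ t ∈ T, s * t * s⁻¹ ∈ Subgroup.closure T ⊔ W := by
    intro s hs t ht
    have := Subgroup.mul_mem_sup (Subgroup.subset_closure ht)
      (show t⁻¹ * ⁅s, t⁆ * t ∈ W from by
        have := (Subgroup.mem_normalizer_iff.1 (hTW (Subgroup.subset_closure (hTi t ht))) _).1
          (hCW s hs t ht)
        simpa using this)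
    rw [commutatorElement_def] at this
    group at this ⊢
    exact this
  have hTS : ∀ t ∈ T, ∀ s ∈ S, t * s * t⁻¹ ∈ Subgroup.closure S ⊔ W := by
    intro t ht s hs
    rw [sup_comm]
    have := Subgroup.mul_mem_sup (Subgroup.inv_mem _ (hCW s hs t ht))
      (Subgroup.subset_closure hs)
    rw [commutatorElement_def] at this
    group at this ⊢
    exact this
  -- Conjugation by `s` sends `y ∈ ⟨T⟩` into `⟨T⟩W` and `d` into `W₁ ≤ W`, and `⟨T⟩W` normalizes
  -- `W`.
  have hSW : Subgroup.closure S ≤ Subgroup.normalizer (W : Set G) := by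
    refine closure_le_normalizer_closure hSi ?_
    rintro s hs _ ⟨y, hy, d, hd, rfl⟩
    have h1 : s * y * s⁻¹ ∈ Subgroup.closure T ⊔ W := by
      have : Subgroup.closure T ≤
          (Subgroup.closure T ⊔ W).comap (MulAut.conj s).toMonoidHom :=
        (Subgroup.closure_le _).2 fun t ht => hST s hs t ht
      exact this hy
    have h2 : s * d * s⁻¹ ∈ W := hW₁W <| (Subgroup.mem_normalizer_iff.1
      (le_normalizer_conjClosure _ C (Subgroup.subset_closure hs)) d).1 (hDW hd)
    have h3 := (Subgroup.mem_normalizer_iff.1 (sup_le hTW Subgroup.le_normalizer h1) _).1 h2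
    have : s * (y * d * y⁻¹) * s⁻¹ = s * y * s⁻¹ * (s * d * s⁻¹) * (s * y * s⁻¹)⁻¹ := by group
    rw [this]
    exact h3
  obtain ⟨E, hE, -⟩ := (Subgroup.fg_iff _).1 hWfg
  have aux : ∀ {P Q : Set G}, (∀ s ∈ P, s⁻¹ ∈ P) → Subgroup.closure P ≤ Subgroup.normalizer W →
      (∀ s ∈ P, ∀ t ∈ Q, s * t * s⁻¹ ∈ Subgroup.closure Q ⊔ W) →
      Subgroup.closure P ≤ Subgroup.normalizer (Subgroup.closure Q ⊔ W : Subgroup G) := by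
    intro P Q hPi hP hPQ
    rw [← hE, ← Subgroup.closure_union] at hPQ ⊢
    refine closure_le_normalizer_closure hPi ?_
    rintro s hs t (ht | ht)
    · exact hPQ s hs t ht
    · rw [Subgroup.closure_union, hE]
      exact (le_sup_right : W ≤ _) <| (Subgroup.mem_normalizer_iff.1
        (hP (Subgroup.subset_closure hs)) t).1 (hE ▸ Subgroup.subset_closure ht)
  have hU : Group.IsNilpotent (Subgroup.closure S ⊔ W : Subgroup G) :=
    hN.isNilpotent_of_fg (sup_le hSN' (hWNM.trans inf_le_left)) ((closure_fg_of_finite hS).sup hWfg)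
  have hV : Group.IsNilpotent (Subgroup.closure T ⊔ W : Subgroup G) :=
    hM.isNilpotent_of_fg (sup_le hTM' (hWNM.trans inf_le_right))
      ((closure_fg_of_finite hT).sup hWfg)
  refine isNilpotent_of_le ?_ (isNilpotent_sup_of_le_normalizer
    (sup_le (aux hSi hSW hST) (le_sup_right.trans Subgroup.le_normalizer))
    (sup_le (aux hTi hTW hTS) (le_sup_right.trans Subgroup.le_normalizer)) hU hV)
  rw [Subgroup.closure_union]
  exact sup_le_sup le_sup_left le_sup_left

/-- The Hirsch–Plotkin theorem. -/
theorem IsLocallyNilpotent.sup {N M : Subgroup G} [N.Normal] [M.Normal]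
    (hN : IsLocallyNilpotent N) (hM : IsLocallyNilpotent M) :
    IsLocallyNilpotent (N ⊔ M : Subgroup G) := by
  refine isLocallyNilpotent_iff.2 fun H hH hfg => ?_
  obtain ⟨F, rfl, hF⟩ := (Subgroup.fg_iff _).1 hfg
  have hex : ∀ t : F, ∃ n ∈ N, ∃ m ∈ M, n * m = t := fun t =>
    Subgroup.mem_sup_of_normal_left.1 (hH (Subgroup.subset_closure t.2))
  choose n hn m hm hnm using hex
  have := hF.to_subtype
  have key := isNilpotent_closure_union hN hM
    (S := Set.range n ∪ (Set.range n)⁻¹) (T := Set.range m ∪ (Set.range m)⁻¹)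
    ((Set.finite_range n).union (Set.finite_range n).inv)
    ((Set.finite_range m).union (Set.finite_range m).inv)
    (fun s hs => hs.symm.imp id (by simp)) (fun s hs => hs.symm.imp id (by simp))
    (by
      rintro s (⟨t, rfl⟩ | ⟨t, ht⟩)
      · exact hn t
      · exact N.inv_mem_iff.1 (ht ▸ hn t))
    (by
      rintro s (⟨t, rfl⟩ | ⟨t, ht⟩)
      · exact hm t
      · exact M.inv_mem_iff.1 (ht ▸ hm t))
  refine isNilpotent_of_le ((Subgroup.closure_le _).2 fun t ht => ?_) key
  have h := hnm ⟨t, ht⟩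
  dsimp only at h
  rw [← h]
  exact Subgroup.mul_mem _ (Subgroup.subset_closure (Or.inl (Or.inl ⟨_, rfl⟩)))
    (Subgroup.subset_closure (Or.inr (Or.inl ⟨_, rfl⟩)))

theorem isLocallyNilpotent_bot : IsLocallyNilpotent (⊥ : Subgroup G) :=
  fun _ _ => inferInstance

variable (G) in
theorem hirschPlotkinRadical_normal : (hirschPlotkinRadical G).Normal :=
  Subgroup.sSup_normal _ fun _ h => h.1

variable (G) in
theorem isLocallyNilpotent_hirschPlotkinRadical :
    IsLocallyNilpotent (hirschPlotkinRadical G) := by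
  have hdir : DirectedOn (· ≤ ·) {N : Subgroup G | N.Normal ∧ IsLocallyNilpotent N} := by
    rintro N ⟨hN, hN'⟩ M ⟨hM, hM'⟩
    exact ⟨N ⊔ M, ⟨inferInstance, hN'.sup hM'⟩, le_sup_left, le_sup_right⟩
  have hne : {N : Subgroup G | N.Normal ∧ IsLocallyNilpotent N}.Nonempty :=
    ⟨⊥, inferInstance, isLocallyNilpotent_bot⟩
  refine isLocallyNilpotent_iff.2 fun H hH hfg => ?_
  obtain ⟨F, rfl, hF⟩ := (Subgroup.fg_iff _).1 hfg
  have hF' : F ⊆ ⋃ N ∈ {N : Subgroup G | N.Normal ∧ IsLocallyNilpotent N}, (N : Set G) := by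
    intro t ht
    have := hH (Subgroup.subset_closure ht)
    rw [hirschPlotkinRadical, Subgroup.mem_sSup_of_directedOn hne hdir] at this
    obtain ⟨N, hN, htN⟩ := this
    exact Set.mem_biUnion hN htN
  obtain ⟨N, hN, hFN⟩ := DirectedOn.exists_mem_subset_of_finset_subset_biUnion
    (s := hF.toFinset) hne (fun N hN M hM => hdir N hN M hM) (by simpa using hF')
  exact hN.2.isNilpotent_of_fg ((Subgroup.closure_le _).2 (by simpa using hFN)) hfg

/-- Descent along the lower central series of `F = ⟨x, E⟩`: if `x = kc` with `k ∈ K = ⟨E⟩` and `c`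
in the `i`-th term, then `x y x⁻¹ = k[c, y]y k⁻¹` for `y ∈ K`. So `K` and its conjugate by `x`,
hence `x` itself, lie in the join of `K` with the next term. -/
theorem mem_of_mem_closure_sup_conj {E : Set G} {x : G}
    (hnil : Group.IsNilpotent (Subgroup.closure (insert x E)))
    (hx : x ∈ Subgroup.closure E ⊔ MulAut.conj x • Subgroup.closure E) :
    x ∈ Subgroup.closure E := by
  obtain ⟨n, hn⟩ := (Subgroup.isNilpotent_iff_lowerCentralSeries _).1 hnil
  set F := Subgroup.closure (insert x E) with hF
  set K := Subgroup.closure E with hK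
  have hKF : K ≤ F := Subgroup.closure_mono (Set.subset_insert _ _)
  have key : ∀ i, x ∈ K ⊔ F.lowerCentralSeries i := by
    intro i
    induction i with
    | zero => exact (le_sup_right : F ≤ _) (Subgroup.subset_closure (Set.mem_insert _ _))
    | succ i ih =>
      have hKn : K ≤ Subgroup.normalizer (F.lowerCentralSeries i : Set G) :=
        hKF.trans (F.self_le_normalizer_lowerCentralSeries i)
      rw [← SetLike.mem_coe, Subgroup.coe_mul_of_left_le_normalizer_right _ _ hKn] at ih
      obtain ⟨k, hk, c, hc, rfl⟩ := ih
      refine (sup_le le_sup_left ?_ : K ⊔ _ ≤ _) hx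
      rintro _ ⟨y, hy, rfl⟩
      have h1 : ⁅c, y⁆ ∈ F.lowerCentralSeries (i + 1) :=
        Subgroup.commutator_mem_commutator hc (hKF hy)
      have hk' := (le_sup_left : K ≤ K ⊔ F.lowerCentralSeries (i + 1)) hk
      have hy' := (le_sup_left : K ≤ K ⊔ F.lowerCentralSeries (i + 1)) hy
      have := Subgroup.mul_mem _ (Subgroup.mul_mem _ (Subgroup.mul_mem _ hk'
        ((le_sup_right : _ ≤ K ⊔ F.lowerCentralSeries (i + 1)) h1)) hy') (Subgroup.inv_mem _ hk')
      rw [commutatorElement_def] at this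
      simp only [MulDistribMulAction.toMonoidEnd_apply, MulDistribMulAction.toMonoidHom_apply,
        MulAut.smul_def, MulAut.conj_apply]
      group at this ⊢
      exact this
  have := key n
  rwa [hn, sup_bot_eq] at this

theorem IsPronormal.normal_of_le {H R : Subgroup G} [R.Normal] (hR : IsLocallyNilpotent R)
    (hHR : H ≤ R) (hH : IsPronormal H) : H.Normal := by
  have hconj : ∀ g : G, MulAut.conj g • H = H := by
    intro g
    obtain ⟨x, hx, hxg⟩ := hH g
    rw [← hxg] at hx ⊢
    refine Subgroup.conj_smul_eq_self_of_mem ?_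
    have hxR : x ∈ R := by
      refine (sup_le hHR ?_ : H ⊔ MulAut.conj x • H ≤ R) hx
      rintro _ ⟨y, hy, rfl⟩
      exact Subgroup.Normal.conj_mem inferInstance y (hHR hy) x
    rw [← H.closure_eq, Subgroup.smul_closure, ← Subgroup.closure_union] at hx
    obtain ⟨T, hTH, hT, hxT⟩ := exists_finite_of_mem_closure hx
    -- Elements of `T` in the conjugate of `H` are pulled back to `H`, so that `x ∈ ⟨E, xEx⁻¹⟩` with
    -- `E ⊆ H` finite.
    let E : Set G := T ∩ H ∪ (MulAut.conj x⁻¹ • T) ∩ H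
    have hEH : E ⊆ H := Set.union_subset Set.inter_subset_right Set.inter_subset_right
    have hE : E.Finite := (hT.inter_of_left _).union ((hT.image _).inter_of_left _)
    have hxE : x ∈ Subgroup.closure E := by
      refine mem_of_mem_closure_sup_conj (hR.isNilpotent_of_fg ((Subgroup.closure_le _).2
        (Set.insert_subset hxR (hEH.trans hHR))) (closure_fg_of_finite (hE.insert x))) ?_
      rw [Subgroup.smul_closure, ← Subgroup.closure_union]
      refine Subgroup.closure_mono ?_ hxT
      intro t ht
      rcases hTH ht with h | h
      · exact Or.inl (Or.inl ⟨ht, h⟩)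
      · obtain ⟨y, hy, rfl⟩ := h
        refine Or.inr ⟨y, Or.inr ⟨⟨_, ht, ?_⟩, hy⟩, rfl⟩
        simp [mul_assoc]
    exact (Subgroup.closure_le _).2 hEH hxE
  refine ⟨fun n hn g => ?_⟩
  rw [← hconj g]
  exact ⟨n, hn, rfl⟩

end HirschPlotkin

/-! ### Independent sequences of commuting elements. -/

section IndependentSequences

variable {G : Type u} [Group G]

theorem mem_closure_image {a : ℕ → G} {I : Set ℕ} {i : ℕ} (hi : i ∈ I) :
    a i ∈ Subgroup.closure (a '' I) :=
  Subgroup.subset_closure (Set.mem_image_of_mem a hi)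

/-- The elements `a n` are nontrivial, commute with each other, and generate the direct product
of the cyclic subgroups that they generate. -/
structure IsIndependentSeq (a : ℕ → G) : Prop where
  ne_one : ∀ n, a n ≠ 1
  commute : ∀ i j, Commute (a i) (a j)
  disjoint : ∀ I J : Set ℕ, Disjoint I J →
    Disjoint (Subgroup.closure (a '' I)) (Subgroup.closure (a '' J))

theorem IsIndependentSeq.commute_of_mem {a : ℕ → G} (ha : IsIndependentSeq a) {I J : Set ℕ} {x y : G}
    (hx : x ∈ Subgroup.closure (a '' I)) (hy : y ∈ Subgroup.closure (a '' J)) : Commute x y := by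
  have h1 : ∀ i, ∀ y ∈ Subgroup.closure (a '' J), Commute (a i) y := by
    intro i y hy
    have : Subgroup.closure (a '' J) ≤ Subgroup.centralizer {a i} := by
      refine (Subgroup.closure_le _).2 ?_
      rintro _ ⟨j, -, rfl⟩
      exact Subgroup.mem_centralizer_singleton_iff.2 (ha.commute j i)
    exact (Subgroup.mem_centralizer_singleton_iff.1 (this hy)).symm
  have : Subgroup.closure (a '' I) ≤ Subgroup.centralizer {y} := by
    refine (Subgroup.closure_le _).2 ?_
    rintro _ ⟨i, -, rfl⟩
    exact Subgroup.mem_centralizer_singleton_iff.2 (h1 i y hy)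
  exact Subgroup.mem_centralizer_singleton_iff.1 (this hx)

theorem IsIndependentSeq.of_mem_closure {a c : ℕ → G} (ha : IsIndependentSeq a) {T : ℕ → Set ℕ}
    (hT : Pairwise fun i j => Disjoint (T i) (T j)) (hc : ∀ n, c n ∈ Subgroup.closure (a '' T n))
    (hc1 : ∀ n, c n ≠ 1) : IsIndependentSeq c where
  ne_one := hc1
  commute i j := ha.commute_of_mem (hc i) (hc j)
  disjoint I J hIJ := by
    have hle : ∀ I : Set ℕ, Subgroup.closure (c '' I) ≤ Subgroup.closure (a '' ⋃ i ∈ I, T i) := by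
      refine fun I => (Subgroup.closure_le _).2 ?_
      rintro _ ⟨i, hi, rfl⟩
      exact Subgroup.closure_mono (Set.image_mono (Set.subset_biUnion_of_mem hi)) (hc i)
    refine (ha.disjoint _ _ ?_).mono (hle I) (hle J)
    refine Set.disjoint_iUnion₂_left.2 fun i hi => Set.disjoint_iUnion₂_right.2 fun j hj => hT ?_
    rintro rfl
    exact Set.disjoint_left.1 hIJ hi hj

theorem IsIndependentSeq.map {H : Type*} [Group H] {a : ℕ → H} (ha : IsIndependentSeq a)
    {f : H →* G} (hf : Function.Injective f) : IsIndependentSeq fun n => f (a n) where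
  ne_one n h := ha.ne_one n (hf (h.trans f.map_one.symm))
  commute i j := (ha.commute i j).map f
  disjoint I J hIJ := by
    have h : ∀ I : Set ℕ, Subgroup.closure ((fun n => f (a n)) '' I) =
        (Subgroup.closure (a '' I)).map f := fun I => by
      rw [MonoidHom.map_closure, Set.image_image]
    rw [h, h, disjoint_iff, ← Subgroup.map_inf _ _ _ hf, (ha.disjoint I J hIJ).eq_bot,
      Subgroup.map_bot]

theorem IsIndependentSeq.injective {a : ℕ → G} (ha : IsIndependentSeq a) :
    Function.Injective a := by
  intro i j h
  by_contra hij
  refine ha.ne_one i (Subgroup.disjoint_def.1 (ha.disjoint {i} {j} (by simpa using hij)) ?_ ?_)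
  · exact mem_closure_image rfl
  · exact h ▸ mem_closure_image rfl

/-- A subgroup either avoids a tail of an independent sequence, or contains an independent
sequence of products of the given one. -/
theorem IsIndependentSeq.disjoint_or_exists {a : ℕ → G} (ha : IsIndependentSeq a)
    (X : Subgroup G) : (∃ n, Disjoint X (Subgroup.closure (a '' Set.Ici n))) ∨
      ∃ c : ℕ → G, IsIndependentSeq c ∧ (∀ i, c i ∈ X) ∧
        ∀ i, ∃ n, c i ∈ Subgroup.closure (a '' Set.Iio n) := by
  by_cases h : ∃ n, Disjoint X (Subgroup.closure (a '' Set.Ici n))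
  · exact Or.inl h
  right
  have hex : ∀ n, ∃ y : G, ∃ m, n ≤ m ∧ y ∈ X ∧ y ≠ 1 ∧
      y ∈ Subgroup.closure (a '' Set.Ico n m) := by
    intro n
    have hn : ¬ Disjoint X (Subgroup.closure (a '' Set.Ici n)) := fun hd => h ⟨n, hd⟩
    rw [Subgroup.disjoint_def] at hn
    push Not at hn
    obtain ⟨y, hyX, hy, hy1⟩ := hn
    obtain ⟨T, hTs, hT, hyT⟩ := exists_finite_of_mem_closure hy
    obtain ⟨S, hS, hSfin, rfl⟩ := Set.Finite.exists_subset_finite_image_eq hT hTs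
    obtain ⟨m, hm⟩ := hSfin.bddAbove
    have hSm : S ⊆ Set.Ico n (max n (m + 1)) := fun i hi =>
      ⟨hS hi, lt_max_of_lt_right (Nat.lt_succ_of_le (hm hi))⟩
    exact ⟨y, max n (m + 1), le_max_left _ _, hyX, hy1,
      Subgroup.closure_mono (Set.image_mono hSm) hyT⟩
  choose f m hm hfX hf1 hf using hex
  -- Iterating `m` cuts `ℕ` into successive blocks; the chosen elements have disjoint supports.
  let t : ℕ → ℕ := fun k => Nat.rec 0 (fun _ n => m n) k
  have ht : Monotone t := monotone_nat_of_le_succ fun k => hm (t k)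
  refine ⟨fun k => f (t k), ha.of_mem_closure (T := fun k => Set.Ico (t k) (t (k + 1)))
    ht.pairwise_disjoint_on_Ico_succ (fun k => hf (t k)) (fun k => hf1 _), fun k => hfX _,
    fun k => ⟨m (t k), Subgroup.closure_mono (Set.image_mono fun i hi => hi.2) (hf (t k))⟩⟩

/-- A cyclic group contains no infinite independent sequence: if `x ^ r` and `x ^ s` are
independent, then `x ^ (r * s) = 1`, so `⟨x⟩` is finite. -/
theorem IsIndependentSeq.exists_disjoint_zpowers {a : ℕ → G} (ha : IsIndependentSeq a) (x : G) :
    ∃ n, Disjoint (Subgroup.zpowers x) (Subgroup.closure (a '' Set.Ici n)) := by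
  refine (ha.disjoint_or_exists (Subgroup.zpowers x)).resolve_right ?_
  rintro ⟨c, hc, hcx, -⟩
  obtain ⟨r, hr⟩ := hcx 0
  obtain ⟨s, hs⟩ := hcx 1
  dsimp only at hr hs
  have hrs : x ^ (r * s) = 1 := by
    refine Subgroup.disjoint_def.1 (hc.disjoint {0} {1} (by simp)) ?_ ?_
    · rw [zpow_mul, hr]
      exact Subgroup.zpow_mem _ (mem_closure_image (Set.mem_singleton 0)) s
    · rw [mul_comm, zpow_mul, hs]
      exact Subgroup.zpow_mem _ (mem_closure_image (Set.mem_singleton 1)) r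
  have hrs0 : r * s ≠ 0 := by
    refine mul_ne_zero ?_ ?_
    · rintro rfl
      exact hc.ne_one 0 (by rw [← hr, zpow_zero])
    · rintro rfl
      exact hc.ne_one 1 (by rw [← hs, zpow_zero])
  have hfin : Finite (Subgroup.zpowers x) :=
    finite_zpowers.2 (isOfFinOrder_iff_zpow_eq_one.2 ⟨_, hrs0, hrs⟩)
  exact not_injective_infinite_finite (fun n => (⟨c n, hcx n⟩ : Subgroup.zpowers x))
    fun i j hij => hc.injective (Subtype.ext_iff.1 hij)

theorem le_normalizer_closure_image {X : Subgroup G} {a : ℕ → G}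
    (h : ∀ n, X ≤ Subgroup.normalizer (Subgroup.zpowers (a n) : Set G)) (I : Set ℕ) :
    X ≤ Subgroup.normalizer (Subgroup.closure (a '' I) : Set G) := by
  refine Subgroup.le_normalizer_closure_iff.2 ?_
  rintro x hx _ ⟨i, hi, rfl⟩
  have := (Subgroup.mem_normalizer_iff.1 (h i hx) (a i)).1 (Subgroup.mem_zpowers _)
  exact (Subgroup.zpowers_le.2 (mem_closure_image hi)) this

/-- Factorizations `x b` with `b ∈ ⟨a n : n ∈ S⟩` are unique. This recovers `X` from two pronormal
overgroups. -/
theorem IsIndependentSeq.sup_inf_sup_eq {a : ℕ → G} (ha : IsIndependentSeq a) {X : Subgroup G}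
    {S I J : Set ℕ} (h : ∀ n, X ≤ Subgroup.normalizer (Subgroup.zpowers (a n) : Set G))
    (hX : Disjoint X (Subgroup.closure (a '' S))) (hI : I ⊆ S) (hJ : J ⊆ S) (hIJ : Disjoint I J) :
    (X ⊔ Subgroup.closure (a '' I)) ⊓ (X ⊔ Subgroup.closure (a '' J)) = X := by
  refine le_antisymm ?_ (le_inf le_sup_left le_sup_left)
  rintro y ⟨hyI, hyJ⟩
  change y ∈ ((X ⊔ _ : Subgroup G) : Set G) at hyI hyJ
  rw [Subgroup.coe_mul_of_left_le_normalizer_right _ _ (le_normalizer_closure_image h _)]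
    at hyI hyJ
  obtain ⟨x, hx, b, hb, rfl⟩ := hyI
  obtain ⟨x', hx', b', hb', hxb⟩ := hyJ
  dsimp only at hxb ⊢
  have h1 : x⁻¹ * x' = 1 := by
    refine Subgroup.disjoint_def.1 hX (X.mul_mem (X.inv_mem hx) hx') ?_
    have : x⁻¹ * x' = b * b'⁻¹ := by
      rw [eq_mul_inv_iff_mul_eq, mul_assoc, hxb, inv_mul_cancel_left]
    rw [this]
    exact Subgroup.mul_mem _ (Subgroup.closure_mono (Set.image_mono hI) hb)
      (Subgroup.inv_mem _ (Subgroup.closure_mono (Set.image_mono hJ) hb'))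
  obtain rfl := inv_mul_eq_one.1 h1
  obtain rfl := mul_left_cancel hxb
  rw [Subgroup.disjoint_def.1 (ha.disjoint I J hIJ) hb hb', mul_one]
  exact hx

end IndependentSequences

/-! ### Consequences of the antichain condition. -/

section Pronormal

variable {G : Type u} [Group G]

/-- The antichain clause follows from `hjoin`; `ULift` only adjusts the universe of the index type.
-/
theorem AntichainCondition.exists_infinite_join {χ : Subgroup G → Prop}
    (hac : AntichainCondition χ) (H : ℕ → Subgroup G) (hperm : ∀ i j, Permute (H i) (H j))
    (hjoin : ∀ i, ¬ H i ≤ ⨆ j ∈ {j | j ≠ i}, H j) :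
    ∃ I : Set ℕ, I.Infinite ∧ χ (⨆ j ∈ I, H j) := by
  by_contra hcon
  push Not at hcon
  have hsup : ∀ S : Set (ULift.{u} ℕ), ⨆ j ∈ S, H j.down = ⨆ j ∈ ULift.down '' S, H j :=
    fun S => iSup_image.symm
  refine hac (ULift.{u} ℕ) (fun i => H i.down) ⟨inferInstance, ?_, fun i j => hperm _ _, ?_, ?_⟩
  · intro i j hij hle
    refine hjoin i.down (hle.trans (le_biSup H (i := j.down) ?_))
    exact fun h => hij (ULift.ext _ _ h.symm)
  · intro i hle
    refine hjoin i.down (hle.trans ?_)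
    rw [hsup]
    refine biSup_mono ?_
    rintro _ ⟨j, hj, rfl⟩
    exact fun h => hj (ULift.ext _ _ h)
  · intro S hS
    rw [hsup]
    exact hcon _ (hS.image ULift.down_injective.injOn)

theorem permute_sup_of_commute {X A B : Subgroup G}
    (hA : X ≤ Subgroup.normalizer (A : Set G)) (hB : X ≤ Subgroup.normalizer (B : Set G))
    (hAB : ∀ x ∈ A, ∀ y ∈ B, Commute x y) : Permute (X ⊔ A) (X ⊔ B) := by
  have key : ∀ {A B : Subgroup G}, X ≤ Subgroup.normalizer (A : Set G) →
      X ≤ Subgroup.normalizer (B : Set G) → (∀ x ∈ A, ∀ y ∈ B, Commute x y) →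
      ((X ⊔ A : Subgroup G) : Set G) * ((X ⊔ B : Subgroup G) : Set G) ⊆
        ((X ⊔ B : Subgroup G) : Set G) * ((X ⊔ A : Subgroup G) : Set G) := by
    rintro A B hA hB hAB _ ⟨h, hh, k, hk, rfl⟩
    rw [Subgroup.coe_mul_of_left_le_normalizer_right _ _ hA] at hh
    -- Factoring the second element in the opposite order brings the commuting parts `u` and `v`
    -- together.
    rw [sup_comm, Subgroup.coe_mul_of_right_le_normalizer_left _ _ hB] at hk
    obtain ⟨x, hx, u, hu, rfl⟩ := hh
    obtain ⟨v, hv, y, hy, rfl⟩ := hk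
    refine ⟨x * v, Subgroup.mul_mem_sup hx hv, u * y, ?_, ?_⟩
    · rw [sup_comm]
      exact Subgroup.mul_mem_sup hu hy
    · have := (hAB u hu v hv).eq
      simp only [mul_assoc]
      rw [← mul_assoc u v, this, mul_assoc]
  exact Set.Subset.antisymm (key hA hB hAB) (key hB hA fun x hx y hy => (hAB y hy x hx).symm)

/-- The condition is applied to the subgroups `X⟨a i⟩`, `i ∈ S`. They permute, and triviality of `X
⊓ ⟨a n : n ∈ S⟩` keeps each out of the join of the others. -/
theorem IsIndependentSeq.exists_sup_of_antichainCondition {χ : Subgroup G → Prop}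
    (hac : AntichainCondition χ) {a : ℕ → G} (ha : IsIndependentSeq a) {X : Subgroup G}
    {S : Set ℕ} (h : ∀ n, X ≤ Subgroup.normalizer (Subgroup.zpowers (a n) : Set G))
    (hX : Disjoint X (Subgroup.closure (a '' S))) (hS : S.Infinite) :
    ∃ I ⊆ S, I.Infinite ∧ χ (X ⊔ Subgroup.closure (a '' I)) := by
  let e := hS.natEmbedding
  let H : ℕ → Subgroup G := fun i => X ⊔ Subgroup.zpowers (a (e i))
  have hle : ∀ I : Set ℕ, ⨆ i ∈ I, H i ≤ X ⊔ Subgroup.closure (a '' ((fun i => (e i : ℕ)) '' I)) :=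
    fun I => iSup₂_le fun i hi => sup_le_sup_left
      (Subgroup.zpowers_le.2 (mem_closure_image
        (Set.mem_image_of_mem (fun i => (e i : ℕ)) hi))) _
  obtain ⟨I, hI, hχ⟩ := hac.exists_infinite_join H
    (fun i j => permute_sup_of_commute (h _) (h _) (by
      intro x hx y hy
      rw [Subgroup.zpowers_eq_closure, ← Set.image_singleton (f := a)] at hx hy
      exact ha.commute_of_mem hx hy))
    (by
      intro i hi
      have h1 : a (e i) ∈ X ⊔ Subgroup.closure (a '' ((fun i => (e i : ℕ)) '' {j | j ≠ i})) :=
        hle _ (hi ((le_sup_right : _ ≤ H i) (Subgroup.mem_zpowers _)))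
      rw [← SetLike.mem_coe,
        Subgroup.coe_mul_of_left_le_normalizer_right _ _ (le_normalizer_closure_image h _)] at h1
      obtain ⟨x, hx, b, hb, hxb⟩ := h1
      dsimp only at hxb
      have hx1 : x = 1 := by
        refine Subgroup.disjoint_def.1 hX hx ?_
        rw [← eq_mul_inv_iff_mul_eq] at hxb
        rw [hxb]
        refine Subgroup.mul_mem _ (mem_closure_image (e i).2)
          (Subgroup.inv_mem _ (Subgroup.closure_mono (Set.image_mono ?_) hb))
        rintro _ ⟨j, -, rfl⟩
        exact (e j).2
      rw [hx1, one_mul] at hxb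
      refine ha.ne_one (e i) (Subgroup.disjoint_def.1 (ha.disjoint {(e i : ℕ)} _ ?_)
        (mem_closure_image rfl) (hxb ▸ hb))
      rw [Set.disjoint_singleton_left]
      rintro ⟨j, hj, hji⟩
      exact hj (e.injective (Subtype.ext hji)))
  refine ⟨(fun i => (e i : ℕ)) '' I, ?_,
    hI.image (Subtype.val_injective.comp e.injective).injOn, ?_⟩
  · rintro _ ⟨i, -, rfl⟩
    exact (e i).2
  · convert hχ using 1
    refine le_antisymm (sup_le ?_ ((Subgroup.closure_le _).2 ?_)) (hle I)
    · obtain ⟨i, hi⟩ := hI.nonempty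
      exact le_sup_left.trans (le_biSup H hi)
    · rintro _ ⟨_, ⟨i, hi, rfl⟩, rfl⟩
      exact (le_biSup H hi) ((le_sup_right : _ ≤ H i) (Subgroup.mem_zpowers _))

theorem exists_infinite_disjoint_subset_Ici (n : ℕ) :
    ∃ I J : Set ℕ, I.Infinite ∧ J.Infinite ∧ I ⊆ Set.Ici n ∧ J ⊆ Set.Ici n ∧ Disjoint I J := by
  refine ⟨Set.range fun k => 2 * (n + k), Set.range fun k => 2 * (n + k) + 1,
    Set.infinite_range_of_injective fun i j => ?_, Set.infinite_range_of_injective fun i j => ?_,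
    ?_, ?_, ?_⟩
  · simp
  · simp
  · rintro _ ⟨k, rfl⟩
    simp only [Set.mem_Ici]
    omega
  · rintro _ ⟨k, rfl⟩
    simp only [Set.mem_Ici]
    omega
  · rw [Set.disjoint_left]
    rintro _ ⟨k, rfl⟩ ⟨l, hl⟩
    dsimp only at hl
    omega

theorem IsIndependentSeq.normal_zpowers_of_mem
    (hac : AntichainCondition (IsPronormal : Subgroup G → Prop)) {R : Subgroup G} [R.Normal]
    (hR : IsLocallyNilpotent R) {a : ℕ → G} (ha : IsIndependentSeq a) (haR : ∀ i, a i ∈ R)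
    {b : G} {n : ℕ} (hb : b ∈ Subgroup.closure (a '' Set.Iio n)) :
    (Subgroup.zpowers b).Normal := by
  have hcl : ∀ I : Set ℕ, Subgroup.closure (a '' I) ≤ R := fun I =>
    (Subgroup.closure_le _).2 (by rintro _ ⟨i, -, rfl⟩; exact haR i)
  have hbB : Subgroup.zpowers b ≤ Subgroup.closure (a '' Set.Iio n) := Subgroup.zpowers_le.2 hb
  have hdis : Disjoint (Subgroup.zpowers b) (Subgroup.closure (a '' Set.Ici n)) :=
    (ha.disjoint (Set.Iio n) (Set.Ici n)
      (Set.disjoint_left.2 fun i hi hi' => not_lt.2 (Set.mem_Ici.1 hi') hi)).mono_left hbB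
  have hnor : ∀ i, Subgroup.zpowers b ≤ Subgroup.normalizer (Subgroup.zpowers (a i) : Set G) := by
    refine fun i => Subgroup.le_normalizer_iff.2 fun x hx y hy => ?_
    have hy' : y ∈ Subgroup.closure (a '' {i}) := by
      rwa [Set.image_singleton, ← Subgroup.zpowers_eq_closure]
    rwa [(ha.commute_of_mem (hbB hx) hy').eq, mul_inv_cancel_right]
  obtain ⟨I, J, hI, hJ, hIn, hJn, hIJ⟩ := exists_infinite_disjoint_subset_Ici n
  obtain ⟨I', hI', -, hpI⟩ :=
    ha.exists_sup_of_antichainCondition hac hnor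
      (hdis.mono_right (Subgroup.closure_mono (Set.image_mono hIn))) hI
  obtain ⟨J', hJ', -, hpJ⟩ :=
    ha.exists_sup_of_antichainCondition hac hnor
      (hdis.mono_right (Subgroup.closure_mono (Set.image_mono hJn))) hJ
  have hnI := hpI.normal_of_le hR (sup_le (hbB.trans (hcl _)) (hcl _))
  have hnJ := hpJ.normal_of_le hR (sup_le (hbB.trans (hcl _)) (hcl _))
  rw [← ha.sup_inf_sup_eq hnor hdis (hI'.trans hIn) (hJ'.trans hJn) (hIJ.mono hI' hJ')]
  infer_instance

/-- Both `⟨x⟩B` and its conjugate by `k` lie in `YB`, so the conjugating element may be taken there,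
and `YB` normalizes `XB`. -/
theorem IsPronormal.conj_mem_sup {x k : G} {B X Y : Subgroup G} [B.Normal]
    (hpro : IsPronormal (Subgroup.zpowers x ⊔ B)) (hXY : X ≤ Y)
    (hYX : Y ≤ Subgroup.normalizer (X : Set G)) (hk : k ∈ Subgroup.normalizer (Y : Set G))
    (hx : x ∈ X) : k * x * k⁻¹ ∈ X ⊔ B := by
  obtain ⟨y, hy, hyk⟩ := hpro k
  have hle : Subgroup.zpowers x ⊔ B ≤ X ⊔ B := sup_le_sup_right (Subgroup.zpowers_le.2 hx) _
  have hYB : (Y : Subgroup G) ⊔ B ≤ Subgroup.normalizer (X ⊔ B : Subgroup G) := by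
    refine Subgroup.le_normalizer_iff.2 fun g hg z hz => ?_
    obtain ⟨u, hu, b, hb, rfl⟩ := Subgroup.mem_sup_of_normal_right.1 hg
    have h1 : b * z * b⁻¹ ∈ X ⊔ B := (X ⊔ B).mul_mem
      ((X ⊔ B).mul_mem ((le_sup_right : B ≤ _) hb) hz) ((le_sup_right : B ≤ _) (B.inv_mem hb))
    obtain ⟨v, hv, c, hc, hvc⟩ := Subgroup.mem_sup_of_normal_right.1 h1
    have : u * b * z * (u * b)⁻¹ = u * v * u⁻¹ * (u * c * u⁻¹) := by
      have : u * b * z * (u * b)⁻¹ = u * (b * z * b⁻¹) * u⁻¹ := by group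
      rw [this, ← hvc]
      group
    rw [this]
    exact Subgroup.mul_mem_sup ((Subgroup.mem_normalizer_iff.1 (hYX hu) v).1 hv)
      (Subgroup.Normal.conj_mem inferInstance c hc u)
  have hyY : y ∈ Y ⊔ B := by
    refine (sup_le (hle.trans (sup_le_sup_right hXY _)) ?_ : _ ≤ Y ⊔ B) hy
    rintro _ ⟨z, hz, rfl⟩
    obtain ⟨u, hu, b, hb, rfl⟩ := Subgroup.mem_sup_of_normal_right.1 hz
    have hmem := Subgroup.mul_mem_sup ((Subgroup.mem_normalizer_iff.1 hk u).1
      ((Subgroup.zpowers_le.2 (hXY hx)) hu)) (Subgroup.Normal.conj_mem inferInstance b hb k)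
    have heq : k * u * k⁻¹ * (k * b * k⁻¹) = k * (u * b) * k⁻¹ := by group
    rw [heq] at hmem
    exact hmem
  have hmem : k * x * k⁻¹ ∈ MulAut.conj k • (Subgroup.zpowers x ⊔ B) :=
    ⟨x, (le_sup_left : Subgroup.zpowers x ≤ _) (Subgroup.mem_zpowers x), rfl⟩
  rw [← hyk] at hmem
  obtain ⟨z, hz, hzk⟩ := hmem
  rw [← hzk]
  exact (Subgroup.mem_normalizer_iff.1 (hYB hyY) z).1 (hle hz)

theorem conj_mem_of_antichainCondition
    (hac : AntichainCondition (IsPronormal : Subgroup G → Prop)) {R : Subgroup G} [R.Normal]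
    (hR : IsLocallyNilpotent R) {a : ℕ → G} (ha : IsIndependentSeq a) (haR : ∀ i, a i ∈ R)
    {x k : G} {X Y : Subgroup G} (hXY : X ≤ Y) (hYX : Y ≤ Subgroup.normalizer (X : Set G))
    (hk : k ∈ Subgroup.normalizer (Y : Set G)) (hx : x ∈ X) : k * x * k⁻¹ ∈ X := by
  have key : ∀ {c : ℕ → G}, IsIndependentSeq c →
      (∀ i, ∃ n, c i ∈ Subgroup.closure (a '' Set.Iio n)) → ∀ S : Set ℕ, S.Infinite →
      ∃ I ⊆ S, k * x * k⁻¹ ∈ X ⊔ Subgroup.closure (c '' I) := by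
    intro c hc hca S hS
    have hcn : ∀ i, (Subgroup.zpowers (c i)).Normal := fun i =>
      (hca i).elim fun n hn => ha.normal_zpowers_of_mem hac hR haR hn
    obtain ⟨n, hn⟩ := hc.exists_disjoint_zpowers x
    obtain ⟨I, hI, -, hpro⟩ := hc.exists_sup_of_antichainCondition hac
      (S := S ∩ Set.Ici n) (fun i => have := hcn i; Subgroup.le_normalizer_of_normal)
      (hn.mono_right (Subgroup.closure_mono (Set.image_mono Set.inter_subset_right)))
      (by
        have := hS.sdiff (Set.finite_Iio n)
        rwa [Set.sdiff_eq, Set.compl_Iio] at this)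
    have hBn : (Subgroup.closure (c '' I)).Normal :=
      Subgroup.normalizer_eq_top_iff.1 (top_le_iff.1 (le_normalizer_closure_image
        (fun i => have := hcn i; Subgroup.le_normalizer_of_normal) I))
    exact ⟨I, hI.trans Set.inter_subset_left, hpro.conj_mem_sup hXY hYX hk hx⟩
  have hmem : ∀ i, ∃ n, a i ∈ Subgroup.closure (a '' Set.Iio n) := fun i =>
    ⟨i + 1, mem_closure_image (Nat.lt_succ_self i)⟩
  -- In the first case two disjoint index sets remove the factor `B`; in the second, `B` is
  -- generated by elements of `X`.
  rcases ha.disjoint_or_exists X with ⟨n, hn⟩ | ⟨c, hc, hcX, hca⟩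
  · obtain ⟨I, J, hI, hJ, hIn, hJn, hIJ⟩ := exists_infinite_disjoint_subset_Ici n
    obtain ⟨I', hI', hxI⟩ := key ha hmem I hI
    obtain ⟨J', hJ', hxJ⟩ := key ha hmem J hJ
    have hnor : ∀ i, X ≤ Subgroup.normalizer (Subgroup.zpowers (a i) : Set G) := fun i =>
      have := (hmem i).elim fun n hn => ha.normal_zpowers_of_mem hac hR haR hn
      Subgroup.le_normalizer_of_normal
    rw [← ha.sup_inf_sup_eq hnor hn
      (hI'.trans hIn) (hJ'.trans hJn) (hIJ.mono hI' hJ')]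
    exact ⟨hxI, hxJ⟩
  · obtain ⟨I, -, hxI⟩ := key hc hca Set.univ Set.infinite_univ
    refine (sup_le le_rfl ((Subgroup.closure_le _).2 ?_) : X ⊔ _ ≤ X) hxI
    rintro _ ⟨i, -, rfl⟩
    exact hcX i

theorem isTBarGroup_of_isIndependentSeq
    (hac : AntichainCondition (IsPronormal : Subgroup G → Prop)) {R : Subgroup G} [R.Normal]
    (hR : IsLocallyNilpotent R) {a : ℕ → G} (ha : IsIndependentSeq a) (haR : ∀ i, a i ∈ R) :
    IsTBarGroup G := by
  intro K H hH
  -- Along the subnormal series `Y` is already normal in `K`, so only subnormality in two steps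
  -- needs treatment.
  induction hH with
  | top => infer_instance
  | step H Y hHY _ hN ih =>
    have hYH := (Subgroup.normal_subgroupOf_iff_le_normalizer hHY).1 hN
    refine ⟨fun h hh k => ?_⟩
    have := conj_mem_of_antichainCondition hac hR ha haR (x := (h : G)) (k := (k : G))
      (X := H.map K.subtype) (Y := Y.map K.subtype) (Subgroup.map_mono hHY)
      ((Subgroup.map_mono hYH).trans (Subgroup.le_normalizer_map _))
      (Subgroup.le_normalizer_map _ ⟨k, by rw [Subgroup.normalizer_eq_top]; trivial, rfl⟩)
      ⟨h, hh, rfl⟩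
    obtain ⟨z, hz, hzk⟩ := this
    have : z = k * h * k⁻¹ := Subtype.ext hzk
    exact this ▸ hz

end Pronormal

/-! ### From infinite total rank to an independent sequence. -/

section InfiniteRank

open Cardinal

/-- The embedding `f` covers both ranks: `M = A` over `ℤ`, and the `p`-torsion over `ZMod p`. -/
theorem isIndependentSeq_of_linearIndependent {A : Type*} [CommGroup A] {k M : Type*} [Ring k]
    [Nontrivial k] [AddCommGroup M] [Module k M] {f : M →+ Additive A}
    (hf : Function.Injective f) {v : ℕ → M} (hv : LinearIndependent k v) :
    IsIndependentSeq fun n => (f (v n)).toMul where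
  ne_one n h := hv.ne_zero n (hf (by rw [map_zero]; exact h))
  commute i j := Commute.all _ _
  disjoint I J hIJ := by
    have h : ∀ I : Set ℕ, ∀ x ∈ Subgroup.closure ((fun n => (f (v n)).toMul) '' I),
        ∃ y ∈ Submodule.span k (v '' I), f y = Additive.ofMul x := by
      intro I x hx
      induction hx using Subgroup.closure_induction with
      | mem x hx =>
        obtain ⟨i, hi, rfl⟩ := hx
        exact ⟨v i, Submodule.subset_span ⟨i, hi, rfl⟩, rfl⟩
      | one => exact ⟨0, Submodule.zero_mem _, f.map_zero⟩
      | mul x y _ _ hx hy =>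
        obtain ⟨x', hx', hx⟩ := hx
        obtain ⟨y', hy', hy⟩ := hy
        exact ⟨x' + y', Submodule.add_mem _ hx' hy', by rw [map_add, hx, hy, ofMul_mul]⟩
      | inv x _ hx =>
        obtain ⟨x', hx', hx⟩ := hx
        exact ⟨-x', Submodule.neg_mem _ hx', by rw [map_neg, hx, ofMul_inv]⟩
    refine Subgroup.disjoint_def.2 fun {x} hxI hxJ => ?_
    obtain ⟨y, hy, hyx⟩ := h I x hxI
    obtain ⟨z, hz, hzx⟩ := h J x hxJ
    obtain rfl := hf (hyx.trans hzx.symm)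
    rw [Submodule.disjoint_def.1 (hv.disjoint_span_image hIJ) y hy hz, map_zero] at hyx
    exact hyx.symm

theorem exists_linearIndependent_nat {k : Type*} {M : Type u} [Ring k] [AddCommGroup M]
    [Module k M] [HasRankNullity.{u} k] (h : ℵ₀ ≤ Module.rank k M) :
    ∃ v : ℕ → M, LinearIndependent k v := by
  obtain ⟨s, hs, hli⟩ := exists_set_linearIndependent k M
  have : Infinite s := infinite_iff.2 (hs ▸ h)
  exact ⟨_, hli.comp _ (Infinite.natEmbedding s).injective⟩

theorem isIndependentSeq_of_orderOf_eq_prime {A : Type*} [CommGroup A] {p : ℕ → ℕ}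
    (hp : ∀ n, (p n).Prime) (hinj : Function.Injective p) {a : ℕ → A}
    (ha : ∀ n, a n ^ p n = 1) (ha1 : ∀ n, a n ≠ 1) : IsIndependentSeq a where
  ne_one := ha1
  commute i j := Commute.all _ _
  disjoint I J hIJ := by
    have hind : iSupIndep fun n => Submodule.torsionBy ℤ (Additive A) (p n : ℤ) :=
      iSupIndep_iff_supIndep.2 fun S => Submodule.supIndep_torsionBy fun i _ j _ hij =>
        Nat.isCoprime_iff_coprime.2 ((Nat.coprime_primes (hp i) (hp j)).2 (hinj.ne hij))
    have h : ∀ I : Set ℕ, ∀ x ∈ Subgroup.closure (a '' I),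
        Additive.ofMul x ∈ ⨆ n ∈ I, Submodule.torsionBy ℤ (Additive A) (p n : ℤ) := by
      intro I x hx
      induction hx using Subgroup.closure_induction with
      | mem x hx =>
        obtain ⟨i, hi, rfl⟩ := hx
        refine Submodule.mem_iSup_of_mem i (Submodule.mem_iSup_of_mem hi ?_)
        rw [Submodule.mem_torsionBy_iff, natCast_zsmul, ← ofMul_pow, ha, ofMul_one]
      | one => exact Submodule.zero_mem _
      | mul x y _ _ hx hy => exact Submodule.add_mem _ hx hy
      | inv x _ hx => exact Submodule.neg_mem _ hx
    exact Subgroup.disjoint_def.2 fun {x} hxI hxJ =>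
      Submodule.disjoint_def.1 (hind.disjoint_biSup_biSup hIJ) _ (h I x hxI) (h J x hxJ)

theorem sum_lt_aleph0_of_finite {ι : Type*} {f : ι → Cardinal} (hf : ∀ i, f i < ℵ₀)
    (hfin : {i | f i ≠ 0}.Finite) : Cardinal.sum f < ℵ₀ := by
  have := hfin.to_subtype
  have hfi : ∀ i, Finite (f i).out := fun i => by
    rw [← lt_aleph0_iff_finite, mk_out]
    exact hf i
  have : Finite (Σ i, (f i).out) := by
    refine Finite.of_injective (β := Σ i : {i | f i ≠ 0}, (f i).out)
      (fun z => ⟨⟨z.1, fun h => ?_⟩, z.2⟩) ?_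
    · have := mk_ne_zero_iff.2 ⟨z.2⟩
      rw [mk_out] at this
      exact this h
    · rintro ⟨i, x⟩ ⟨j, y⟩ h
      simp only [Sigma.mk.injEq, Subtype.mk.injEq] at h
      obtain ⟨rfl, h⟩ := h
      rw [eq_of_heq h]
  have h := lt_aleph0_iff_finite.2 this
  rw [mk_sigma] at h
  simpa using h

/-- The sum is infinite only if `r₀` is, some `r_p` is, or infinitely many `r_p` are nonzero. In the
last case elements of distinct prime orders are independent. -/
theorem exists_isIndependentSeq_of_totalRank {A : Type u} [CommGroup A] (h : ℵ₀ ≤ totalRank A) :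
    ∃ a : ℕ → A, IsIndependentSeq a := by
  by_cases h0 : ℵ₀ ≤ torsionFreeRank A
  · obtain ⟨v, hv⟩ := exists_linearIndependent_nat h0
    exact ⟨_, isIndependentSeq_of_linearIndependent (f := AddMonoidHom.id _)
      Function.injective_id hv⟩
  by_cases hp : ∃ p : Nat.Primes, ℵ₀ ≤ pRank p A
  · obtain ⟨p, hp⟩ := hp
    have : Fact (p : ℕ).Prime := ⟨p.2⟩
    let _ : Module (ZMod p) (AddSubgroup.torsionBy (Additive A) ((p : ℕ) : ℤ)) :=
      AddSubgroup.torsionBy.zmodModule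
    obtain ⟨v, hv⟩ := exists_linearIndependent_nat (k := ZMod p) hp
    exact ⟨_, isIndependentSeq_of_linearIndependent
      (f := (AddSubgroup.torsionBy (Additive A) ((p : ℕ) : ℤ)).subtype)
      Subtype.val_injective hv⟩
  push Not at h0 hp
  have hinf : {p : Nat.Primes | pRank p A ≠ 0}.Infinite := fun hfin =>
    absurd h (not_le.2 (add_lt_aleph0 h0 (sum_lt_aleph0_of_finite hp hfin)))
  let e := hinf.natEmbedding
  have hex : ∀ n, ∃ x : A, x ^ ((e n : Nat.Primes) : ℕ) = 1 ∧ x ≠ 1 := by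
    intro n
    by_contra hcon
    push Not at hcon
    refine (e n).2 ?_
    have : Subsingleton (AddSubgroup.torsionBy (Additive A) (((e n : Nat.Primes) : ℕ) : ℤ)) := by
      refine subsingleton_of_forall_eq 0 fun y => Subtype.ext ?_
      exact hcon y.1.toMul (AddSubgroup.torsionBy.nsmul_iff.1 y.2)
    let _ : Module (ZMod (e n : Nat.Primes))
        (AddSubgroup.torsionBy (Additive A) (((e n : Nat.Primes) : ℕ) : ℤ)) :=
      AddSubgroup.torsionBy.zmodModule
    have : Fact ((e n : Nat.Primes) : ℕ).Prime := ⟨(e n : Nat.Primes).2⟩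
    exact rank_subsingleton' _ _
  choose a ha ha1 using hex
  exact ⟨a, isIndependentSeq_of_orderOf_eq_prime (fun n => (e n : Nat.Primes).2)
    (fun i j hij => e.injective (Subtype.ext (Subtype.ext hij))) ha ha1⟩

open scoped IsMulCommutative in
theorem HasInfiniteTotalRank.exists_isIndependentSeq {G : Type u} [Group G]
    (h : HasInfiniteTotalRank G) : ∃ a : ℕ → G, IsIndependentSeq a := by
  obtain ⟨A, hA, h⟩ := h
  obtain ⟨a, ha⟩ := exists_isIndependentSeq_of_totalRank h
  exact ⟨_, ha.map A.subtype_injective⟩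

end InfiniteRank

end GroupAntichain

theorem mainTheorem8 (G : Type u) [Group G]
    (hac : GroupAntichain.AntichainCondition
      (GroupAntichain.IsPronormal : Subgroup G → Prop))
    (hR : GroupAntichain.HasInfiniteTotalRank (GroupAntichain.hirschPlotkinRadical G)) :
    GroupAntichain.IsTBarGroup G := by
  obtain ⟨a, ha⟩ := hR.exists_isIndependentSeq
  have := GroupAntichain.hirschPlotkinRadical_normal G
  exact GroupAntichain.isTBarGroup_of_isIndependentSeq hac
    (GroupAntichain.isLocallyNilpotent_hirschPlotkinRadical G)
    (ha.map (GroupAntichain.hirschPlotkinRadical G).subtype_injective) fun i => (a i).2
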